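/- Let $K\ge 1$, let $\Omega\subseteq\mathbb R^2$ be measurable, and let $f\ge 0$ be an integrable density of mobile terminals on $\Omega$ (normalized or not). Let the $K$ base stations stand at distinct points of the plane, let $d_i(x)$ be the Euclidean distance from $x$ to the $i$-th station, and let $\sigma>0$, $R\ge 0$, $\xi>0$. Put $F_i(x)=\sigma^2(R^2+d_i(x)^2)^{\xi/2}$, and assume $\int_\Omega F_i f\,dx<\infty$ for every $i$ (automatic for bounded $\Omega$). For $\mathrm{MAX}_i\ge 0$ and functions $\bar\kappa_i$ let $$s_i(t)=\kappa_i(t)=\begin{cases}0,& t\le \mathrm{MAX}_i,\\ \bar\kappa_i(t-\mathrm{MAX}_i),& t>\mathrm{MAX}_i,\end{cases}$$ and assume that each $s_i$ is non-decreasing and convex on $[0,\infty)$ (for instance $\bar\kappa_i(u)=c_i u$ with a constant $c_i\ge 0$, or $\bar\kappa_i(u)=c_iu^2$). Consider the rate-fair allocation problem with overflow penalty $$\min_{(C_i)}\ \sum_{i=1}^K\int_{C_i}\bigl[F_i(x)+s_i(N_i)\bigr]f(x)\,dx,\qquad N_i=\int_{C_i}f(x)\,dx,$$ over all partitions $(C_i)_{i=1}^K$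 of $\Omega$ into measurable cells (possibly empty). 1. The problem has an optimal partition, and it is unique: the $i$-th cells of any two optimal partitions agree up to a set of $f\,dx$-measure zero, for every $i$. 2. A partition $(C_i)$ of $\Omega$ into measurable cells, with $N_i=\int_{C_i}f\,dx$, is optimal if and only if there are numbers $g_i$, each a subgradient at $N_i$ of $s_i$ as a function on $[0,\infty)$ (that is, $s_i(u)\ge s_i(N_i)+g_i(u-N_i)$ for all $u\ge 0$), such that for every $i$, up to a set of $f\,dx$-measure zero, $$C_i=\{x\in\Omega:\ F_i(x)+s_i(N_i)+N_i\,g_i\le F_j(x)+s_j(N_j)+N_j\,g_j\ \text{ for all } j\}.$$ 3. In particular, if each $s_i$ is differentiable at $N_i$ (as is always the case when the $s_i$ are continuously differentiable), the partition is optimal if and only if for every $i$, up to a set of $f\,dx$-measure zero, $$C_i=\{x\in\Omega:\ \sigma^2(R^2+d_i(x)^2)^{\xi/2}+s_i(N_i)+N_i\,s_i'(N_i)\le \sigma^2(R^2+d_j(x)^2)^{\xi/2}+s_j(N_j)+N_j\,s_j'(N_j)\ \text{ for all } j\}.$$ -/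

import Mathlib

open MeasureTheory

noncomputable section

/-- The plane, with its Euclidean distance. -/
abbrev Plane : Type := EuclideanSpace ℝ (Fin 2)

/-- The carrier-overflow penalty `κ`: zero up to the capacity `M`, then `κbar (t - M)`. -/
def overflowPenalty (M : ℝ) (κbar : ℝ → ℝ) (t : ℝ) : ℝ :=
  if t ≤ M then 0 else κbar (t - M)

/-- The power `σ² (R² + d²)^(ξ/2)` for a mobile at `x` and a base station at `b`. -/
def linkPower (σ R ξ : ℝ) (b x : Plane) : ℝ :=
  σ ^ 2 * (R ^ 2 + dist x b ^ 2) ^ (ξ / 2)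

/-- The amount `∫_A f` of mobiles in `A`, for the deployment density `f`. -/
def mobilesIn (f : Plane → ℝ) (A : Set Plane) : ℝ := ∫ x in A, f x

/-- The measure on `Ω` with density `f`. -/
def mobileMeasure (Ω : Set Plane) (f : Plane → ℝ) : Measure Plane :=
  (volume.restrict Ω).withDensity fun x => ENNReal.ofReal (f x)

/-- `C` is a partition of `Ω` into measurable cells (some of which may be empty). -/
structure IsCellPartition {K : ℕ} (Ω : Set Plane) (C : Fin K → Set Plane) : Prop where
  measurableSet : ∀ i, MeasurableSet (C i)
  disjoint : Pairwise fun i j => Disjoint (C i) (C j)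
  iUnion_eq : ⋃ i, C i = Ω

/-- The cost `∑ i, ∫_{C i} [F i (x) + s i (N i)] f(x) dx`, with `N i = ∫_{C i} f`. -/
def partitionCost {K : ℕ} (F : Fin K → Plane → ℝ) (s : Fin K → ℝ → ℝ) (f : Plane → ℝ)
    (C : Fin K → Set Plane) : ℝ :=
  ∑ i, ∫ x in C i, (F i x + s i (mobilesIn f (C i))) * f x

/-- `C` minimizes the cost among all cell partitions of `Ω`. -/
def IsOptimalPartition {K : ℕ} (Ω : Set Plane) (F : Fin K → Plane → ℝ) (s : Fin K → ℝ → ℝ)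
    (f : Plane → ℝ) (C : Fin K → Set Plane) : Prop :=
  IsCellPartition Ω C ∧
    ∀ D : Fin K → Set Plane, IsCellPartition Ω D →
      partitionCost F s f C ≤ partitionCost F s f D

/-- The set of `x ∈ Ω` with `F i x + s i (n i) + n i * g i ≤ F j x + s j (n j) + n j * g j`
for all `j`. -/
def associationCell {K : ℕ} (Ω : Set Plane) (F : Fin K → Plane → ℝ) (s : Fin K → ℝ → ℝ)
    (n g : Fin K → ℝ) (i : Fin K) : Set Plane :=
  {x | x ∈ Ω ∧ ∀ j, F i x + s i (n i) + n i * g i ≤ F j x + s j (n j) + n j * g j}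

/-- `g` is a subgradient at `t` of `s` as a function on `[0, ∞)`. For convex `s` and `t > 0`
this means that `g` lies between the left and the right derivative of `s` at `t`. -/
def IsLoadSubgradient (s : ℝ → ℝ) (t g : ℝ) : Prop :=
  ∀ u : ℝ, 0 ≤ u → s t + g * (u - t) ≤ s u

end

/-!
If station `i` charges a fixed price `h i` on top of `F i`, the best partition sends every mobile
to a cheapest station and costs `∫ ⨅ j, (F j + h j)`. This value is concave in `h`, and since ties
are null, its derivative in `h i` is the load of the `i`-th price cell. Prescribing the loads and
relaxing that constraint by prices gives a Lagrangian which is convex in the loads, concave in the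
prices and has a saddle point by Sion's theorem. At the saddle point the prices are the marginal
costs `s i (N i) + N i * g i` of the loads of their own price cells. Conversely, as `t * s i t` is
convex, the cells of such an equilibrium cost no more than any other partition, with equality only
if the other partition, too, sends almost every mobile to its cheapest station.

Ties are null because a level set of `F i - F j` of positive measure would contain points outside
the line through the two stations at which the gradient of `F i - F j` vanishes, whereas the
gradients of `F i` and `F j` point along `x - b i` and `x - b j`, which are parallel only on that
line.
-/

open Set Filter Function
open scoped Topology

section LoadPenalty

variable {s : ℝ → ℝ} {n : ℝ}

theorem continuousOn_Ici_of_monotoneOn_of_convexOn {a : ℝ} (hmono : MonotoneOn s (Ici a))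
    (hconv : ConvexOn ℝ (Ici a) s) : ContinuousOn s (Ici a) := by
  refine hconv.continuousOn_Ici ?_
  have hchord : Tendsto (fun t => s a + (t - a) * (s (a + 1) - s a)) (𝓝[≥] a) (𝓝 (s a)) := by
    refine Tendsto.mono_left ?_ nhdsWithin_le_nhds
    exact Continuous.tendsto' (by fun_prop) _ _ (by ring)
  refine tendsto_of_tendsto_of_tendsto_of_le_of_le' tendsto_const_nhds hchord ?_ ?_
  · filter_upwards [self_mem_nhdsWithin] with t ht using hmono self_mem_Ici ht ht
  · filter_upwards [Icc_mem_nhdsGE (lt_add_one a)] with t ht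
    have hmix := hconv.2 self_mem_Ici (mem_Ici.2 (le_add_of_nonneg_right zero_le_one))
      (sub_nonneg.2 (sub_le_iff_le_add'.2 ht.2)) (sub_nonneg.2 ht.1) (sub_add_cancel 1 (t - a))
    have hpoint : (1 - (t - a)) * a + (t - a) * (a + 1) = t := by ring
    simp only [smul_eq_mul, hpoint] at hmix
    linarith

theorem continuousOn_id_mul (hmono : MonotoneOn s (Ici 0)) (hconv : ConvexOn ℝ (Ici 0) s) :
    ContinuousOn (fun t => t * s t) (Ici 0) :=
  continuousOn_id.mul (continuousOn_Ici_of_monotoneOn_of_convexOn hmono hconv)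

theorem monotoneOn_id_mul_sub (hmono : MonotoneOn s (Ici 0)) :
    MonotoneOn (fun t => t * (s t - s 0)) (Ici 0) := fun _ ht _ hu htu =>
  mul_le_mul htu (sub_le_sub_right (hmono ht hu htu) _) (sub_nonneg.2 (hmono self_mem_Ici ht ht)) hu

theorem convexOn_id_mul (hmono : MonotoneOn s (Ici 0)) (hconv : ConvexOn ℝ (Ici 0) s) :
    ConvexOn ℝ (Ici 0) fun t => t * s t := by
  have hshift : ConvexOn ℝ (Ici 0) fun t => t * (s t - s 0) := by
    refine (convexOn_id (convex_Ici 0)).mul (hconv.sub (concaveOn_const _ (convex_Ici 0)))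
      (fun _ ht => ht) (fun _ ht => sub_nonneg.2 (hmono self_mem_Ici ht ht)) ?_
    exact MonotoneOn.monovaryOn (fun _ _ _ _ htu => htu) fun _ ht _ hu htu =>
      sub_le_sub_right (hmono ht hu htu) _
  have hlinear : ConvexOn ℝ (Ici 0) fun t => s 0 * t :=
    (LinearMap.mulLeft ℝ (s 0)).convexOn (convex_Ici 0)
  exact (hshift.add hlinear).congr fun t _ => by simp only [Pi.add_apply]; ring

theorem isLoadSubgradient_of_isMinOn_Icc {φ : ℝ → ℝ} {b m : ℝ} (hφ : ConvexOn ℝ (Ici 0) φ)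
    (hn : 0 ≤ n) (hnm : n < m) (hmin : IsMinOn (fun u => φ u - b * u) (Icc 0 m) n) :
    IsLoadSubgradient φ n b := by
  have hlocal : IsLocalMinOn (fun u => φ u - b * u) (Ici 0) n := by
    filter_upwards [self_mem_nhdsWithin, mem_nhdsWithin_of_mem_nhds (Iio_mem_nhds hnm)]
      with u hu hum using hmin ⟨hu, hum.le⟩
  have hconv : ConvexOn ℝ (Ici 0) fun u => φ u - b * u :=
    hφ.sub ((LinearMap.mulLeft ℝ b).concaveOn (convex_Ici 0))
  intro u hu
  have hle := isMinOn_iff.1 (IsMinOn.of_isLocalMinOn_of_convexOn hn hlocal hconv) u hu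
  linarith

namespace IsLoadSubgradient

theorem id_mul {g : ℝ} (hg : IsLoadSubgradient s n g) (hmono : MonotoneOn s (Ici 0))
    (hn : 0 ≤ n) : IsLoadSubgradient (fun t => t * s t) n (s n + n * g) := by
  intro u hu
  rcases hn.eq_or_lt with rfl | hpos
  · have := mul_le_mul_of_nonneg_left (hmono self_mem_Ici hu hu) hu
    linarith
  · have hg_nonneg : 0 ≤ g := by
      refine (mul_nonneg_iff_of_pos_left hpos).1 ?_
      linarith [hg 0 le_rfl, hmono self_mem_Ici hn hn]
    calc n * s n + (s n + n * g) * (u - n)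
        = u * (s n + g * (u - n)) - g * (u - n) ^ 2 := by ring
      _ ≤ u * (s n + g * (u - n)) := sub_le_self _ (by positivity)
      _ ≤ u * s u := mul_le_mul_of_nonneg_left (hg u hu) hu

/-- With `σ u = s u - s n - g (u - n)`, the hypothesis reads `u σ(u) + g (u - n)² ≥ 0`. Evaluating
it at `n + r (u - n)`, where `σ` is at most `r σ(u)` by convexity, and letting `r` tend to `0` in
the quotient by `r` gives `n σ(u) ≥ 0`. -/
theorem of_id_mul {g : ℝ} (hconv : ConvexOn ℝ (Ici 0) s) (hn : 0 < n)
    (h : IsLoadSubgradient (fun t => t * s t) n (s n + n * g)) : IsLoadSubgradient s n g := by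
  intro u hu
  set δ := s u - s n - g * (u - n) with hδ
  have hquot : ∀ r ∈ Ioc (0 : ℝ) 1, 0 ≤ (n + r * (u - n)) * δ + g * r * (u - n) ^ 2 := by
    rintro r ⟨hr, hr1⟩
    have hv : (1 - r) * n + r * u = n + r * (u - n) := by ring
    have hv0 : 0 ≤ n + r * (u - n) := by
      rw [← hv]
      exact add_nonneg (mul_nonneg (sub_nonneg.2 hr1) hn.le) (mul_nonneg hr.le hu)
    have hmix := hconv.2 (mem_Ici.2 hn.le) (mem_Ici.2 hu) (sub_nonneg.2 hr1) hr.le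
      (sub_add_cancel 1 r)
    simp only [smul_eq_mul, hv] at hmix
    refine (mul_nonneg_iff_of_pos_left hr).1 ?_
    have := mul_le_mul_of_nonneg_left hmix hv0
    linear_combination this + h _ hv0 + (n + r * (u - n)) * r * hδ
  have hlim : Tendsto (fun r => (n + r * (u - n)) * δ + g * r * (u - n) ^ 2) (𝓝[>] 0)
      (𝓝 (n * δ)) :=
    (Continuous.tendsto' (by fun_prop) _ _ (by ring)).mono_left nhdsWithin_le_nhds
  have hδ_nonneg : 0 ≤ δ := by
    refine (mul_nonneg_iff_of_pos_left hn).1 (ge_of_tendsto hlim ?_)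
    filter_upwards [Ioc_mem_nhdsGT one_pos] with r hr using hquot r hr
  linarith

theorem exists_eq_add_mul_of_id_mul {b : ℝ} (hmono : MonotoneOn s (Ici 0))
    (hconv : ConvexOn ℝ (Ici 0) s) (hn : 0 ≤ n) (hb : s 0 ≤ b)
    (h : IsLoadSubgradient (fun t => t * s t) n b) :
    ∃ g, IsLoadSubgradient s n g ∧ b = s n + n * g := by
  rcases hn.eq_or_lt with rfl | hpos
  · refine ⟨0, fun u hu => by simpa using hmono self_mem_Ici hu hu, ?_⟩
    have hlim : Tendsto s (𝓝[>] 0) (𝓝 (s 0)) :=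
      (continuousOn_Ici_of_monotoneOn_of_convexOn hmono hconv 0 self_mem_Ici).mono
        Ioi_subset_Ici_self
    have hb_le : b ≤ s 0 := by
      refine ge_of_tendsto hlim ?_
      filter_upwards [self_mem_nhdsWithin] with u (hu : 0 < u)
      refine le_of_mul_le_mul_left ?_ hu
      linarith [h u hu.le]
    linarith
  · have hbg : b = s n + n * ((b - s n) / n) := by field_simp; ring
    exact ⟨(b - s n) / n, of_id_mul hconv hpos (hbg ▸ h), hbg⟩

theorem eq_deriv {g : ℝ} (hg : IsLoadSubgradient s n g) (hn : 0 < n)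
    (hd : DifferentiableAt ℝ s n) : g = deriv s n := by
  have hmin : IsLocalMin (fun u => s u - g * u) n := by
    filter_upwards [Ioi_mem_nhds hn] with u hu
    linarith [hg u hu.le]
  have hderiv := hd.hasDerivAt.sub ((hasDerivAt_id n).const_mul g)
  linarith [hmin.hasDerivAt_eq_zero hderiv]

end IsLoadSubgradient

theorem isLoadSubgradient_deriv (hconv : ConvexOn ℝ (Ici 0) s) (hn : 0 ≤ n)
    (hd : DifferentiableAt ℝ s n) : IsLoadSubgradient s n (deriv s n) := by
  intro u hu
  rcases lt_trichotomy u n with hlt | rfl | hgt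
  · have hslope := hconv.slope_le_deriv hu hn hlt hd
    rw [slope_def_field, div_le_iff₀ (sub_pos.2 hlt)] at hslope
    linarith
  · simp
  · have hslope := hconv.deriv_le_slope hn hu hgt hd
    rw [slope_def_field, le_div_iff₀ (sub_pos.2 hgt)] at hslope
    linarith

end LoadPenalty

section PriceCells

variable {α ι : Type*}

/-- The cheapest offer at `x` when station `j` charges the price `h j` on top of `F j x`. -/
noncomputable def shiftedMin (F : ι → α → ℝ) (h : ι → ℝ) (x : α) : ℝ := ⨅ j, (F j x + h j)

/-- The points for which station `i` is a cheapest one at the prices `h`; the cells overlap in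
ties. -/
def priceCell (F : ι → α → ℝ) (h : ι → ℝ) (i : ι) : Set α := {x | ∀ j, F i x + h i ≤ F j x + h j}

/-- For every pair of stations and every pair of prices, the ties between the two stations form a
null set. -/
def HasNullTies [MeasurableSpace α] (μ : Measure α) (F : ι → α → ℝ) : Prop :=
  Pairwise fun i j => ∀ c : ℝ, μ {x | F i x - F j x = c} = 0

theorem HasNullTies.mono_ac [MeasurableSpace α] {μ ν : Measure α} {F : ι → α → ℝ}
    (hties : HasNullTies μ F) (hνμ : ν ≪ μ) : HasNullTies ν F :=
  hties.mono fun _ _ hij c => hνμ (hij c)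

theorem HasNullTies.ae_add_ne_add [MeasurableSpace α] {μ : Measure α} {F : ι → α → ℝ}
    (hties : HasNullTies μ F) {i j : ι} (hij : i ≠ j) (a b : ℝ) :
    ∀ᵐ x ∂μ, F i x + a ≠ F j x + b := by
  filter_upwards [measure_eq_zero_iff_ae_notMem.1 (hties hij (b - a))] with x hx heq
  exact hx (by linear_combination heq)

section Finite

variable [Finite ι] {F : ι → α → ℝ} {h : ι → ℝ} {x : α}

theorem shiftedMin_le (F : ι → α → ℝ) (h : ι → ℝ) (x : α) (i : ι) :
    shiftedMin F h x ≤ F i x + h i :=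
  ciInf_le (finite_range _).bddBelow i

theorem mem_priceCell_iff {i : ι} : x ∈ priceCell F h i ↔ F i x + h i = shiftedMin F h x := by
  have : Nonempty ι := ⟨i⟩
  exact ⟨fun hx => le_antisymm (le_ciInf hx) (shiftedMin_le F h x i),
    fun hx j => hx.trans_le (shiftedMin_le F h x j)⟩

variable [Nonempty ι]

theorem exists_mem_priceCell (F : ι → α → ℝ) (h : ι → ℝ) (x : α) : ∃ i, x ∈ priceCell F h i :=
  Finite.exists_min fun i => F i x + h i

theorem concaveOn_shiftedMin (F : ι → α → ℝ) (x : α) :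
    ConcaveOn ℝ univ fun h => shiftedMin F h x := by
  refine ⟨convex_univ, fun h _ k _ a b ha hb hab => le_ciInf fun i => ?_⟩
  calc a • shiftedMin F h x + b • shiftedMin F k x
      ≤ a * (F i x + h i) + b * (F i x + k i) :=
        add_le_add (mul_le_mul_of_nonneg_left (shiftedMin_le F h x i) ha)
          (mul_le_mul_of_nonneg_left (shiftedMin_le F k x i) hb)
    _ = F i x + (a • h + b • k) i := by
        simp only [Pi.add_apply, Pi.smul_apply, smul_eq_mul]
        linear_combination F i x * hab

theorem shiftedMin_update_le_add_dist [DecidableEq ι] (F : ι → α → ℝ) (h : ι → ℝ) (i : ι) (t u : ℝ)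
    (x : α) : shiftedMin F (update h i t) x ≤ shiftedMin F (update h i u) x + dist t u := by
  obtain ⟨j, hj⟩ := exists_mem_priceCell F (update h i u) x
  rw [← mem_priceCell_iff.1 hj, add_assoc]
  refine (shiftedMin_le F _ x j).trans (add_le_add_right ?_ _)
  rcases eq_or_ne j i with rfl | hji
  · simpa only [update_self, ← sub_le_iff_le_add', Real.dist_eq] using le_abs_self (t - u)
  · simpa only [update_of_ne hji] using le_add_of_nonneg_right dist_nonneg

theorem lipschitzWith_shiftedMin_update [DecidableEq ι] (F : ι → α → ℝ) (h : ι → ℝ) (i : ι)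
    (x : α) : LipschitzWith 1 fun t => shiftedMin F (update h i t) x :=
  LipschitzWith.of_le_add fun t u => shiftedMin_update_le_add_dist F h i t u x

/-- Away from ties, either station `i` is the unique cheapest one near the price `h i`, and the
minimum moves with its price, or some other station is, and the minimum is constant. -/
theorem hasDerivAt_shiftedMin_update [DecidableEq ι] {i : ι}
    (hne : ∀ j ≠ i, F i x + h i ≠ F j x + h j) :
    HasDerivAt (fun t => shiftedMin F (update h i t) x) ((priceCell F h i).indicator 1 x)
      (h i) := by
  by_cases hx : x ∈ priceCell F h i
  · have hcell : ∀ᶠ t in 𝓝 (h i), x ∈ priceCell F (update h i t) i := by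
      refine eventually_all.2 fun j => ?_
      rcases eq_or_ne j i with rfl | hji
      · exact .of_forall fun t => le_rfl
      · have hlt : F i x + h i < F j x + h j := (hx j).lt_of_ne (hne j hji)
        filter_upwards [Iio_mem_nhds (lt_sub_iff_add_lt'.2 hlt)] with t ht
        simpa only [update_self, update_of_ne hji] using (lt_sub_iff_add_lt'.1 ht).le
    have hderiv := (hasDerivAt_id (h i)).const_add (F i x)
    simp only [indicator_of_mem hx, Pi.one_apply]
    refine hderiv.congr_of_eventuallyEq ?_
    filter_upwards [hcell] with t ht
    rw [← mem_priceCell_iff.1 ht, update_self, id]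
  · obtain ⟨j, hj⟩ := exists_mem_priceCell F h x
    have hji : j ≠ i := by
      rintro rfl
      exact hx hj
    have hlt : F j x + h j < F i x + h i := (hj i).lt_of_ne (hne j hji).symm
    have hcell : ∀ᶠ t in 𝓝 (h i), x ∈ priceCell F (update h i t) j := by
      filter_upwards [Ioi_mem_nhds (sub_lt_iff_lt_add'.2 hlt)] with t ht k
      rcases eq_or_ne k i with rfl | hki
      · simpa only [update_self, update_of_ne hji] using (sub_lt_iff_lt_add'.1 ht).le
      · simpa only [update_of_ne hji, update_of_ne hki] using hj k
    simp only [indicator_of_notMem hx]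
    refine (hasDerivAt_const (h i) (F j x + h j)).congr_of_eventuallyEq ?_
    filter_upwards [hcell] with t ht
    rw [← mem_priceCell_iff.1 ht, update_of_ne hji]

end Finite

section Integral

variable [MeasurableSpace α] {μ : Measure α} {F : ι → α → ℝ}

theorem nullMeasurableSet_priceCell [Countable ι] (hF : ∀ i, AEMeasurable (F i) μ) (h : ι → ℝ)
    (i : ι) : NullMeasurableSet (priceCell F h i) μ := by
  rw [priceCell, ofPred_forall]
  exact .iInter fun j => nullMeasurableSet_le ((hF i).add_const _) ((hF j).add_const _)

variable [Finite ι] [Nonempty ι] [IsFiniteMeasure μ]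

theorem integrable_shiftedMin (hF : ∀ i, Integrable (F i) μ) (h : ι → ℝ) :
    Integrable (shiftedMin F h) μ := by
  have := Fintype.ofFinite ι
  have hshift (i : ι) : Integrable (fun x => F i x + h i) μ := (hF i).add (integrable_const _)
  have hmeas : AEStronglyMeasurable (shiftedMin F h) μ :=
    (AEMeasurable.iInf fun i => (hshift i).aemeasurable).aestronglyMeasurable
  refine (integrable_finsetSum Finset.univ fun i _ => (hshift i).norm).mono' hmeas
    (.of_forall fun x => ?_)
  obtain ⟨i, hi⟩ := exists_mem_priceCell F h x
  rw [← mem_priceCell_iff.1 hi]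
  exact Finset.single_le_sum (f := fun j => ‖F j x + h j‖) (fun _ _ => norm_nonneg _)
    (Finset.mem_univ i)

theorem concaveOn_integral_shiftedMin (hF : ∀ i, Integrable (F i) μ) :
    ConcaveOn ℝ univ fun h => ∫ x, shiftedMin F h x ∂μ := by
  refine ⟨convex_univ, fun h _ k _ a b ha hb hab => ?_⟩
  simp only [smul_eq_mul, ← integral_const_mul]
  rw [← integral_add ((integrable_shiftedMin hF h).const_mul a)
    ((integrable_shiftedMin hF k).const_mul b)]
  exact integral_mono (((integrable_shiftedMin hF h).const_mul a).add
    ((integrable_shiftedMin hF k).const_mul b)) (integrable_shiftedMin hF _)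
    fun x => (concaveOn_shiftedMin F x).2 (mem_univ h) (mem_univ k) ha hb hab

theorem continuous_integral_shiftedMin (hF : ∀ i, Integrable (F i) μ) :
    Continuous fun h => ∫ x, shiftedMin F h x ∂μ :=
  have := Fintype.ofFinite ι
  continuousOn_univ.1 ((concaveOn_integral_shiftedMin hF).continuousOn isOpen_univ)

theorem hasDerivAt_integral_shiftedMin_update [DecidableEq ι] (hF : ∀ i, Integrable (F i) μ)
    (hties : HasNullTies μ F) (h : ι → ℝ) (i : ι) :
    HasDerivAt (fun t => ∫ x, shiftedMin F (update h i t) x ∂μ) (μ.real (priceCell F h i))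
      (h i) := by
  have hcell := nullMeasurableSet_priceCell (fun j => (hF j).aemeasurable) h i
  have hne : ∀ᵐ x ∂μ, ∀ j ≠ i, F i x + h i ≠ F j x + h j :=
    ae_all_iff.2 fun j => eventually_imp_distrib_left.2 fun hji =>
      hties.ae_add_ne_add hji.symm _ _
  have hderiv := (hasDerivAt_integral_of_dominated_loc_of_lip univ_mem
    (.of_forall fun t => (integrable_shiftedMin hF (update h i t)).aestronglyMeasurable)
    (integrable_shiftedMin hF (update h i (h i)))
    (aestronglyMeasurable_one.indicator₀ hcell)
    (.of_forall fun x => by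
      simpa only [map_one] using (lipschitzWith_shiftedMin_update F h i x).lipschitzOnWith)
    (integrable_const (1 : ℝ)) (hne.mono fun x hx => hasDerivAt_shiftedMin_update hx)).2
  rwa [integral_indicator₀ hcell, Pi.one_def, setIntegral_const, smul_eq_mul, mul_one] at hderiv

end Integral

end PriceCells

section Costs

variable {α ι : Type*} [MeasurableSpace α] {μ : Measure α}

/-- A partition up to `μ`-null sets into null-measurable cells. -/
structure IsAEPartition (μ : Measure α) (C : ι → Set α) : Prop where
  nullMeasurableSet : ∀ i, NullMeasurableSet (C i) μ
  aedisjoint : Pairwise (AEDisjoint μ on C)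
  ae_exists_mem : ∀ᵐ x ∂μ, ∃ i, x ∈ C i

/-- The cost of serving `C i` from station `i` at the fixed prices `h`. -/
noncomputable def pricedCost [Fintype ι] (μ : Measure α) (F : ι → α → ℝ) (h : ι → ℝ)
    (C : ι → Set α) : ℝ :=
  ∑ i, ∫ x in C i, (F i x + h i) ∂μ

/-- The cost of `C` when the prices are the load penalties caused by `C` itself. -/
noncomputable def loadCost [Fintype ι] (μ : Measure α) (F : ι → α → ℝ) (s : ι → ℝ → ℝ)
    (C : ι → Set α) : ℝ :=
  pricedCost μ F (fun i => s i (μ.real (C i))) C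

/-- Up to null sets the cells `C` are the price cells of the marginal costs of `t ↦ t * s i t` at
their own loads, computed with the subgradients `g`. -/
structure IsPriceEquilibrium (μ : Measure α) (F : ι → α → ℝ) (s : ι → ℝ → ℝ) (g : ι → ℝ)
    (C : ι → Set α) : Prop where
  isLoadSubgradient : ∀ i, IsLoadSubgradient (s i) (μ.real (C i)) (g i)
  ae_eq_priceCell : ∀ i,
    C i =ᵐ[μ] priceCell F (fun k => s k (μ.real (C k)) + μ.real (C k) * g k) i

variable {F : ι → α → ℝ} {s : ι → ℝ → ℝ} {g h : ι → ℝ} {C D : ι → Set α}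

theorem isPriceEquilibrium_iff : IsPriceEquilibrium μ F s g C ↔
    (∀ i, IsLoadSubgradient (s i) (μ.real (C i)) (g i)) ∧
      ∀ i, C i =ᵐ[μ] priceCell F (fun k => s k (μ.real (C k)) + μ.real (C k) * g k) i :=
  ⟨fun hC => ⟨hC.isLoadSubgradient, hC.ae_eq_priceCell⟩, fun ⟨hg, hcells⟩ => ⟨hg, hcells⟩⟩

namespace IsAEPartition

theorem sum_setIntegral [Fintype ι] (hC : IsAEPartition μ C) {u : α → ℝ} (hu : Integrable u μ) :
    ∑ i, ∫ x in C i, u x ∂μ = ∫ x, u x ∂μ := by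
  have huniv : ⋃ i, C i =ᵐ[μ] univ :=
    eventuallyEq_univ.2 (hC.ae_exists_mem.mono fun x hx => mem_iUnion.2 hx)
  rw [← setIntegral_univ, ← setIntegral_congr_set huniv,
    integral_iUnion_ae hC.nullMeasurableSet hC.aedisjoint hu.integrableOn, tsum_fintype]

theorem ae_eq_of_ae_imp [Countable ι] (hC : IsAEPartition μ C) (hD : IsAEPartition μ D)
    (hsub : ∀ i, ∀ᵐ x ∂μ, x ∈ C i → x ∈ D i) (i : ι) : C i =ᵐ[μ] D i := by
  have hdisj : ∀ᵐ x ∂μ, ∀ j ≠ i, ¬(x ∈ D j ∧ x ∈ D i) :=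
    ae_all_iff.2 fun j => eventually_imp_distrib_left.2 fun hji =>
      measure_eq_zero_iff_ae_notMem.1 (hD.aedisjoint hji)
  refine eventuallyEq_set.2 ?_
  filter_upwards [ae_all_iff.2 hsub, hC.ae_exists_mem, hdisj] with x hx hxC hxD
  refine ⟨hx i, fun hxi => ?_⟩
  obtain ⟨j, hj⟩ := hxC
  obtain rfl : j = i := of_not_not fun hji => hxD j hji ⟨hx j hj, hxi⟩
  exact hj

end IsAEPartition

theorem HasNullTies.isAEPartition_priceCell [Finite ι] [Nonempty ι] (hties : HasNullTies μ F)
    (hF : ∀ i, AEMeasurable (F i) μ) (h : ι → ℝ) : IsAEPartition μ (priceCell F h) where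
  nullMeasurableSet := nullMeasurableSet_priceCell hF h
  aedisjoint := fun i j hij => measure_eq_zero_iff_ae_notMem.2 <| by
    filter_upwards [hties.ae_add_ne_add hij (h i) (h j)] with x hx hmem
    exact hx (le_antisymm (hmem.1 j) (hmem.2 i))
  ae_exists_mem := .of_forall (exists_mem_priceCell F h)

theorem IsPriceEquilibrium.of_differentiableAt (hC : IsPriceEquilibrium μ F s g C)
    (hconv : ∀ i, ConvexOn ℝ (Ici 0) (s i))
    (hd : ∀ i, DifferentiableAt ℝ (s i) (μ.real (C i))) :
    IsPriceEquilibrium μ F s (fun k => deriv (s k) (μ.real (C k))) C where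
  isLoadSubgradient i := isLoadSubgradient_deriv (hconv i) measureReal_nonneg (hd i)
  ae_eq_priceCell := by
    have hprod (k : ι) : μ.real (C k) * g k = μ.real (C k) * deriv (s k) (μ.real (C k)) := by
      rcases measureReal_nonneg.eq_or_lt with hzero | hpos
      · rw [← hzero, zero_mul, zero_mul]
      · rw [(hC.isLoadSubgradient k).eq_deriv hpos (hd k)]
    simpa only [hprod] using hC.ae_eq_priceCell

theorem IsPriceEquilibrium.congr_ae (hC : IsPriceEquilibrium μ F s g C)
    (hCD : ∀ i, C i =ᵐ[μ] D i) : IsPriceEquilibrium μ F s g D where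
  isLoadSubgradient i := measureReal_congr (hCD i) ▸ hC.isLoadSubgradient i
  ae_eq_priceCell i := by
    simp only [← measureReal_congr (hCD _)]
    exact (hCD i).symm.trans (hC.ae_eq_priceCell i)

variable [Fintype ι]

theorem loadCost_eq_pricedCost_add [IsFiniteMeasure μ] (hF : ∀ i, Integrable (F i) μ) (h : ι → ℝ) :
    loadCost μ F s C
      = pricedCost μ F h C + ∑ i, (s i (μ.real (C i)) - h i) * μ.real (C i) := by
  rw [loadCost, pricedCost, pricedCost, ← Finset.sum_add_distrib]
  refine Finset.sum_congr rfl fun i _ => ?_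
  rw [integral_add (hF i).integrableOn (integrable_const _),
    integral_add (hF i).integrableOn (integrable_const _), setIntegral_const, setIntegral_const]
  simp only [smul_eq_mul]
  ring

variable [Nonempty ι] [IsFiniteMeasure μ]

theorem pricedCost_sub_integral_shiftedMin (hF : ∀ i, Integrable (F i) μ)
    (hC : IsAEPartition μ C) (h : ι → ℝ) :
    pricedCost μ F h C - ∫ x, shiftedMin F h x ∂μ
      = ∑ i, ∫ x in C i, (F i x + h i - shiftedMin F h x) ∂μ := by
  have hmin := integrable_shiftedMin hF h
  rw [← hC.sum_setIntegral hmin, pricedCost, ← Finset.sum_sub_distrib]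
  exact Finset.sum_congr rfl fun i _ =>
    (integral_sub ((hF i).add (integrable_const _)).integrableOn hmin.integrableOn).symm

theorem integral_shiftedMin_le_pricedCost (hF : ∀ i, Integrable (F i) μ)
    (hC : IsAEPartition μ C) (h : ι → ℝ) :
    ∫ x, shiftedMin F h x ∂μ ≤ pricedCost μ F h C := by
  rw [← sub_nonneg, pricedCost_sub_integral_shiftedMin hF hC]
  exact Finset.sum_nonneg fun i _ =>
    integral_nonneg fun x => sub_nonneg.2 (shiftedMin_le F h x i)

theorem pricedCost_eq_integral_shiftedMin_iff (hF : ∀ i, Integrable (F i) μ)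
    (hties : HasNullTies μ F) (hC : IsAEPartition μ C) (h : ι → ℝ) :
    pricedCost μ F h C = ∫ x, shiftedMin F h x ∂μ ↔ ∀ i, C i =ᵐ[μ] priceCell F h i := by
  have hgap (i : ι) : 0 ≤ fun x => F i x + h i - shiftedMin F h x :=
    fun x => sub_nonneg.2 (shiftedMin_le F h x i)
  have hgap_int (i : ι) : Integrable (fun x => F i x + h i - shiftedMin F h x) μ :=
    ((hF i).add (integrable_const _)).sub (integrable_shiftedMin hF h)
  have hcell (i : ι) : ∫ x in C i, (F i x + h i - shiftedMin F h x) ∂μ = 0 ↔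
      ∀ᵐ x ∂μ, x ∈ C i → x ∈ priceCell F h i := by
    rw [integral_eq_zero_iff_of_nonneg (hgap i) (hgap_int i).integrableOn,
      ← ae_restrict_iff'₀ (hC.nullMeasurableSet i)]
    simp only [mem_priceCell_iff, ← sub_eq_zero (b := shiftedMin F h _)]
    rfl
  rw [← sub_eq_zero, pricedCost_sub_integral_shiftedMin hF hC,
    Finset.sum_eq_zero_iff_of_nonneg fun i _ => integral_nonneg (hgap i)]
  simp only [Finset.mem_univ, true_imp_iff, hcell]
  refine ⟨hC.ae_eq_of_ae_imp (hties.isAEPartition_priceCell (fun i => (hF i).aemeasurable) h),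
    fun heq i => ?_⟩
  filter_upwards [eventuallyEq_set.1 (heq i)] with x hx using hx.1

namespace IsPriceEquilibrium

variable (hF : ∀ i, Integrable (F i) μ) (hties : HasNullTies μ F)
  (hs : ∀ i, MonotoneOn (s i) (Ici 0)) (hC : IsPriceEquilibrium μ F s g C)
  (hC' : IsAEPartition μ C) (hD : IsAEPartition μ D)

include hF hties hs hC hC' in
theorem loadCost_add_le (D : ι → Set α) :
    loadCost μ F s C + (pricedCost μ F (fun k => s k (μ.real (C k)) + μ.real (C k) * g k) D
      - ∫ x, shiftedMin F (fun k => s k (μ.real (C k)) + μ.real (C k) * g k) x ∂μ)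
        ≤ loadCost μ F s D := by
  set h : ι → ℝ := fun k => s k (μ.real (C k)) + μ.real (C k) * g k
  have hCh : pricedCost μ F h C = ∫ x, shiftedMin F h x ∂μ :=
    (pricedCost_eq_integral_shiftedMin_iff hF hties hC' h).2 hC.ae_eq_priceCell
  have hloads : ∑ i, (s i (μ.real (C i)) - h i) * μ.real (C i)
      ≤ ∑ i, (s i (μ.real (D i)) - h i) * μ.real (D i) := by
    refine Finset.sum_le_sum fun i _ => ?_
    have := (hC.isLoadSubgradient i).id_mul (hs i) measureReal_nonneg _
      (measureReal_nonneg (μ := μ) (s := D i))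
    linear_combination this
  rw [loadCost_eq_pricedCost_add hF h (C := C), loadCost_eq_pricedCost_add hF h (C := D), hCh]
  linarith

include hF hties hs hC hC' hD

theorem loadCost_le : loadCost μ F s C ≤ loadCost μ F s D :=
  le_trans (le_add_of_nonneg_right (sub_nonneg.2 (integral_shiftedMin_le_pricedCost hF hD _)))
    (hC.loadCost_add_le hF hties hs hC' D)

theorem ae_eq_of_loadCost_le (hDC : loadCost μ F s D ≤ loadCost μ F s C) (i : ι) :
    D i =ᵐ[μ] C i := by
  have hgap := (hC.loadCost_add_le hF hties hs hC' D).trans hDC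
  have hcells := (pricedCost_eq_integral_shiftedMin_iff hF hties hD _).1
    (le_antisymm (by linarith) (integral_shiftedMin_le_pricedCost hF hD _))
  exact (hcells i).trans (hC.ae_eq_priceCell i).symm

end IsPriceEquilibrium

end Costs

section Lagrangian

theorem convexOn_finsetSum {E ι : Type*} [AddCommGroup E] [Module ℝ E] {S : Set E}
    {u : ι → E → ℝ} (I : Finset ι) (hS : Convex ℝ S) (hu : ∀ i ∈ I, ConvexOn ℝ S (u i)) :
    ConvexOn ℝ S fun x => ∑ i ∈ I, u i x := by
  simpa only [Finset.sum_fn] using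
    Finset.sum_induction u (ConvexOn ℝ S) (fun _ _ => ConvexOn.add) (convexOn_const 0 hS) hu

variable {ι : Type*} [Fintype ι]

/-- The Lagrangian in the target loads `t` and the prices `h`, where `Φ h` is the least total
priced cost and `φ i (t i)` the cost caused by the load `t i`. -/
noncomputable def lagrangian (Φ : (ι → ℝ) → ℝ) (φ : ι → ℝ → ℝ) (t h : ι → ℝ) : ℝ :=
  Φ h + ∑ i, (φ i (t i) - h i * t i)

theorem sum_apply_update [DecidableEq ι] (G : ι → ℝ → ℝ) (a : ι → ℝ) (i : ι) (u : ℝ) :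
    ∑ j, G j (update a i u j) = ∑ j, G j (a j) + (G i u - G i (a i)) := by
  rw [← sub_eq_iff_eq_add', ← Finset.sum_sub_distrib, Finset.sum_eq_single i, update_self]
  · intro j _ hji
    rw [update_of_ne hji, sub_self]
  · simp

variable {Φ : (ι → ℝ) → ℝ} {φ : ι → ℝ → ℝ} {M : ι → ℝ} {X Y : Set (ι → ℝ)}

theorem exists_isSaddlePointOn_lagrangian (hΦ : ConcaveOn ℝ univ Φ) (hΦ_cont : Continuous Φ)
    (hφ : ∀ i, ConvexOn ℝ (Ici 0) (φ i)) (hφ_cont : ∀ i, ContinuousOn (φ i) (Ici 0)) (hM : 0 ≤ M)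
    (hY : Y.Nonempty) (hY_conv : Convex ℝ Y) (hY_comp : IsCompact Y) :
    ∃ a ∈ Icc 0 M, ∃ b ∈ Y, IsSaddlePointOn (Icc 0 M) Y (lagrangian Φ φ) a b := by
  let coord (i : ι) : (ι → ℝ) →ₗ[ℝ] ℝ := LinearMap.proj i
  have hload_cont (h : ι → ℝ) : ContinuousOn (fun t => lagrangian Φ φ t h) (Icc 0 M) := by
    refine continuousOn_const.add (continuousOn_finsetSum _ fun i _ => ContinuousOn.sub ?_ ?_)
    · exact (hφ_cont i).comp (continuous_apply i).continuousOn fun t ht => ht.1 i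
    · fun_prop
  have hload_conv (h : ι → ℝ) : ConvexOn ℝ (Icc 0 M) fun t => lagrangian Φ φ t h := by
    refine (convexOn_const (Φ h) (convex_Icc 0 M)).add
      (convexOn_finsetSum _ (convex_Icc 0 M) fun i _ => ?_)
    have hφ_coord : ConvexOn ℝ (Icc 0 M) (φ i ∘ coord i) :=
      ((hφ i).comp_linearMap (coord i)).subset (fun t ht => ht.1 i) (convex_Icc 0 M)
    exact hφ_coord.sub ((h i • coord i).concaveOn (convex_Icc 0 M))
  have hprice_cont (t : ι → ℝ) : Continuous fun h => lagrangian Φ φ t h := by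
    unfold lagrangian
    fun_prop
  have hprice_conc (t : ι → ℝ) : ConcaveOn ℝ Y fun h => lagrangian Φ φ t h := by
    have hsum : ConvexOn ℝ Y fun h => ∑ i, (h i * t i - φ i (t i)) :=
      convexOn_finsetSum _ hY_conv fun i _ =>
        (((coord i).smulRight (t i)).convexOn hY_conv).sub (concaveOn_const (φ i (t i)) hY_conv)
    refine ((hΦ.subset (subset_univ _) hY_conv).sub hsum).congr fun h _ => ?_
    simp only [lagrangian, Pi.sub_apply, sub_eq_add_neg (Φ h), ← Finset.sum_neg_distrib, neg_sub]
  exact Sion.exists_isSaddlePointOn ⟨0, left_mem_Icc.2 hM⟩ (convex_Icc 0 M) isCompact_Icc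
    (fun h _ => (hload_cont h).lowerSemicontinuousOn) (fun h _ => (hload_conv h).quasiconvexOn)
    hY_conv hY hY_comp (fun t _ => (hprice_cont t).upperSemicontinuous.upperSemicontinuousOn _)
    (fun t _ => (hprice_conc t).quasiconcaveOn)

variable {a b : ι → ℝ}

theorem isMinOn_load_of_isSaddlePointOn (ha : a ∈ Icc 0 M) (hb : b ∈ Y)
    (hsaddle : IsSaddlePointOn (Icc 0 M) Y (lagrangian Φ φ) a b) (i : ι) :
    IsMinOn (fun u => φ i u - b i * u) (Icc 0 (M i)) (a i) := by
  classical
  refine isMinOn_iff.2 fun u hu => ?_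
  have hmem : update a i u ∈ Icc 0 M :=
    ⟨le_update_iff.2 ⟨hu.1, fun j _ => ha.1 j⟩, update_le_iff.2 ⟨hu.2, fun j _ => ha.2 j⟩⟩
  have hle := hsaddle _ hmem b hb
  rw [lagrangian, lagrangian, sum_apply_update (fun j u => φ j u - b j * u)] at hle
  linarith

theorem isMaxOn_price_of_isSaddlePointOn [DecidableEq ι] {p P : ι → ℝ} (ha : a ∈ X)
    (hb : b ∈ Icc p P) (hsaddle : IsSaddlePointOn X (Icc p P) (lagrangian Φ φ) a b) (i : ι) :
    IsMaxOn (fun v => Φ (update b i v) - v * a i) (Icc (p i) (P i)) (b i) := by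
  refine isMaxOn_iff.2 fun v hv => ?_
  have hmem : update b i v ∈ Icc p P :=
    ⟨le_update_iff.2 ⟨hv.1, fun j _ => hb.1 j⟩, update_le_iff.2 ⟨hv.2, fun j _ => hb.2 j⟩⟩
  have hle := hsaddle a ha _ hmem
  rw [lagrangian, lagrangian, sum_apply_update (fun j v => φ j (a j) - v * a j)] at hle
  simp only [update_eq_self]
  linarith

end Lagrangian

section Existence

theorem mul_sub_nonpos_of_isMaxOn_of_hasDerivAt {ψ : ℝ → ℝ} {ψ' x y : ℝ} {S : Set ℝ}
    (hS : Convex ℝ S) (hmax : IsMaxOn ψ S x) (hψ : HasDerivAt ψ ψ' x) (hx : x ∈ S) (hy : y ∈ S) :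
    ψ' * (y - x) ≤ 0 := by
  have := hmax.localize.hasFDerivWithinAt_nonpos hψ.hasFDerivAt.hasFDerivWithinAt
    (sub_mem_posTangentConeAt_of_segment_subset (hS.segment_subset hx hy))
  simpa [mul_comm] using this

/-- The upper end of the price interval is so high that at this price the target load `a` would
exceed every possible load `n`; there the optimality condition of the prices would fail. -/
theorem isLoadSubgradient_id_mul_of_saddle {s : ℝ → ℝ} {a b n m : ℝ} (hmono : MonotoneOn s (Ici 0))
    (hconv : ConvexOn ℝ (Ici 0) s) (hn : 0 ≤ n) (hnm : n + 1 ≤ m) (ha : a ∈ Icc 0 m)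
    (hb : b ∈ Icc (s 0) (s 0 + m * (s m - s 0) + 1))
    (hload : IsMinOn (fun u => u * s u - b * u) (Icc 0 m) a)
    (hprice : ∀ v ∈ Icc (s 0) (s 0 + m * (s m - s 0) + 1), (n - a) * (v - b) ≤ 0) :
    IsLoadSubgradient (fun u => u * s u) n b := by
  have hm : 0 ≤ m := by linarith
  have hm_cost : 0 ≤ m * (s m - s 0) :=
    mul_nonneg hm (sub_nonneg.2 (hmono self_mem_Ici hm hm))
  have ha_cost : 0 ≤ a * (s a - s 0) :=
    mul_nonneg ha.1 (sub_nonneg.2 (hmono self_mem_Ici ha.1 ha.1))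
  have ha_le : s 0 < b → a ≤ n := fun hlt =>
    sub_nonneg.1 (nonneg_of_mul_nonpos_left (hprice _ (left_mem_Icc.2 (hb.1.trans hb.2)))
      (sub_neg.2 hlt))
  have hb_lt : b < s 0 + m * (s m - s 0) + 1 := by
    refine hb.2.lt_of_ne fun hbP => ?_
    have ham : 1 ≤ m - a := by linarith [ha_le (by linarith)]
    have hle : a * s a - b * a ≤ m * s m - b * m := hload (right_mem_Icc.2 hm)
    have hgap : (b - s 0) * (m - a) ≤ m * (s m - s 0) := by linear_combination hle + ha_cost
    linarith [le_mul_of_one_le_right (sub_nonneg.2 hb.1) ham, hgap]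
  have hn_le : n ≤ a :=
    sub_nonpos.1 (nonpos_of_mul_nonpos_left (hprice _ (right_mem_Icc.2 (hb.1.trans hb.2)))
      (sub_pos.2 hb_lt))
  refine isLoadSubgradient_of_isMinOn_Icc (convexOn_id_mul hmono hconv) hn (by linarith)
    (isMinOn_iff.2 fun u hu => le_trans ?_ (isMinOn_iff.1 hload u hu))
  rcases hb.1.eq_or_lt with rfl | hlt
  · have := monotoneOn_id_mul_sub hmono hn ha.1 hn_le
    simp only [mul_sub] at this
    linarith
  · rw [le_antisymm hn_le (ha_le hlt)]

variable {α ι : Type*} [MeasurableSpace α] {μ : Measure α} [IsFiniteMeasure μ] [Finite ι]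
  [Nonempty ι]

theorem exists_isPriceEquilibrium {F : ι → α → ℝ} {s : ι → ℝ → ℝ} (hF : ∀ i, Integrable (F i) μ)
    (hties : HasNullTies μ F) (hmono : ∀ i, MonotoneOn (s i) (Ici 0))
    (hconv : ∀ i, ConvexOn ℝ (Ici 0) (s i)) :
    ∃ h g : ι → ℝ, IsPriceEquilibrium μ F s g (priceCell F h) := by
  classical
  have := Fintype.ofFinite ι
  set m := μ.real univ + 1
  have hm0 : 0 ≤ m := by positivity
  have hpP (i : ι) : s i 0 ≤ s i 0 + m * (s i m - s i 0) + 1 := by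
    have := mul_nonneg hm0 (sub_nonneg.2 (hmono i self_mem_Ici hm0 hm0))
    linarith
  obtain ⟨a, ha, b, hb, hsaddle⟩ := exists_isSaddlePointOn_lagrangian
    (concaveOn_integral_shiftedMin hF) (continuous_integral_shiftedMin hF)
    (fun i => convexOn_id_mul (hmono i) (hconv i))
    (fun i => continuousOn_id_mul (hmono i) (hconv i)) (M := fun _ => m) (fun _ => hm0)
    (nonempty_Icc.2 hpP) (convex_Icc _ _) isCompact_Icc
  have hsub (i : ι) : IsLoadSubgradient (fun t => t * s i t) (μ.real (priceCell F b i)) (b i) := by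
    refine isLoadSubgradient_id_mul_of_saddle (hmono i) (hconv i) measureReal_nonneg
      (add_le_add_left (measureReal_mono (subset_univ _)) 1) ⟨ha.1 i, ha.2 i⟩ ⟨hb.1 i, hb.2 i⟩
      (isMinOn_load_of_isSaddlePointOn ha hb hsaddle i) fun v hv => ?_
    exact mul_sub_nonpos_of_isMaxOn_of_hasDerivAt (convex_Icc _ _)
      (isMaxOn_price_of_isSaddlePointOn ha hb hsaddle i)
      ((hasDerivAt_integral_shiftedMin_update hF hties b i).sub (hasDerivAt_mul_const (a i)))
      ⟨hb.1 i, hb.2 i⟩ hv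
  choose g hg hbg using fun i => (hsub i).exists_eq_add_mul_of_id_mul (hmono i) (hconv i)
    measureReal_nonneg (hb.1 i)
  exact ⟨b, g, hg, fun i => by simp only [← hbg]; rfl⟩

end Existence

section LevelSets

/-- At almost every point of a set the derivative along the set is determined by the restriction
of the function to the set, as almost every point is a density point. -/
theorem addHaar_eq_zero_of_eqOn_const_of_fderivWithin_ne_zero {V : Type*}
    [NormedAddCommGroup V] [NormedSpace ℝ V] [FiniteDimensional ℝ V] [MeasurableSpace V]
    [BorelSpace V] (μ : Measure V) [μ.IsAddHaarMeasure] {S : Set V} (hS : MeasurableSet S)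
    {u : V → ℝ} {u' : V → V →L[ℝ] ℝ} {c : ℝ} (hu : ∀ x ∈ S, u x = c)
    (hu' : ∀ x ∈ S, HasFDerivWithinAt u (u' x) S x) (hne : ∀ x ∈ S, u' x ≠ 0) : μ S = 0 := by
  rcases S.eq_empty_or_nonempty with rfl | ⟨x₀, hx₀⟩
  · exact measure_empty
  obtain ⟨v, hv⟩ := DFunLike.ne_iff.1 (hne x₀ hx₀)
  have hv0 : v ≠ 0 := by
    rintro rfl
    exact hv (by simp only [map_zero])
  have hconst : ApproximatesLinearOn (fun x => u x • v) (0 : V →L[ℝ] V) S 0 := by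
    intro x hx y hy
    simp [hu x hx, hu y hy]
  have hzero := hconst.norm_fderiv_sub_le μ hS (fun x => (u' x).smulRight v)
    fun x hx => (hu' x hx).smul_const v
  have hfalse : ∀ᵐ _ ∂μ.restrict S, False := by
    filter_upwards [hzero, ae_restrict_mem hS] with x hx hxS
    exact hne x hxS (by simpa [hv0] using hx)
  simpa using hfalse

variable {V : Type*} [NormedAddCommGroup V] [InnerProductSpace ℝ V]

theorem hasFDerivAt_comp_dist_sq {G : ℝ → ℝ} {G' : ℝ} {p x : V}
    (hG : HasDerivAt G G' (dist x p ^ 2)) :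
    HasFDerivAt (fun y => G (dist y p ^ 2)) ((2 * G') • innerSL ℝ (x - p)) x := by
  simp only [dist_eq_norm] at hG ⊢
  have hchain : HasFDerivAt (fun y => G (‖y - p‖ ^ 2)) (G' • 2 • innerSL ℝ (x - p)) x :=
    hG.comp_hasFDerivAt x ((hasFDerivAt_id x).sub_const p).norm_sq
  exact hchain.congr_fderiv (by ext w; simp [mul_left_comm, mul_assoc])

theorem mem_line_of_smul_sub_eq_smul_sub {p q x : V} (hpq : p ≠ q) {α β : ℝ} (hα : α ≠ 0)
    (h : α • (x - p) = β • (x - q)) : x ∈ line[ℝ, p, q] := by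
  have hαβ : α - β ≠ 0 := by
    intro h0
    obtain rfl : α = β := sub_eq_zero.1 h0
    exact hpq (sub_right_injective (smul_right_injective V hα h))
  have hx : x = AffineMap.lineMap p q (-β / (α - β)) := by
    rw [AffineMap.lineMap_apply_module']
    refine smul_right_injective V hαβ ?_
    simp only [smul_add, smul_smul, mul_div_cancel₀ _ hαβ]
    linear_combination (norm := module) h
  exact hx ▸ AffineMap.lineMap_mem_affineSpan_pair _ p q

theorem addHaar_setOf_radial_sub_radial_eq [FiniteDimensional ℝ V] [MeasurableSpace V]
    [BorelSpace V] (μ : Measure V) [μ.IsAddHaarMeasure] (hV : 1 < Module.finrank ℝ V)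
    {G G' : ℝ → ℝ} (hG : Measurable G)
    (hd : ∀ ρ, 0 < ρ → HasDerivAt G (G' ρ) ρ) (hne : ∀ ρ, 0 < ρ → G' ρ ≠ 0) {p q : V}
    (hpq : p ≠ q) (c : ℝ) : μ {x | G (dist x p ^ 2) - G (dist x q ^ 2) = c} = 0 := by
  have hline : μ (line[ℝ, p, q] : Set V) = 0 := by
    refine Measure.addHaar_affineSubspace μ _ fun htop => hV.not_ge ?_
    have := (collinear_pair ℝ p q).finrank_le_one
    rwa [← direction_affineSpan, htop, AffineSubspace.direction_top, finrank_top] at this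
  have hpos {x y : V} (hxy : x ≠ y) : 0 < dist x y ^ 2 := pow_pos (dist_pos.2 hxy) 2
  have hoff : μ ({x | G (dist x p ^ 2) - G (dist x q ^ 2) = c} \ line[ℝ, p, q]) = 0 := by
    have hp {x : V} (hx : x ∉ line[ℝ, p, q]) : x ≠ p :=
      fun h => hx (h ▸ left_mem_affineSpan_pair ℝ p q)
    have hq {x : V} (hx : x ∉ line[ℝ, p, q]) : x ≠ q :=
      fun h => hx (h ▸ right_mem_affineSpan_pair ℝ p q)
    refine addHaar_eq_zero_of_eqOn_const_of_fderivWithin_ne_zero μ ?_ (fun _ hx => hx.1)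
      (fun x hx => ((hasFDerivAt_comp_dist_sq (hd _ (hpos (hp hx.2)))).sub
        (hasFDerivAt_comp_dist_sq (hd _ (hpos (hq hx.2))))).hasFDerivWithinAt)
      fun x hx h0 => hx.2 ?_
    · exact (measurableSet_eq_fun (by fun_prop) measurable_const).diff
        (AffineSubspace.closed_of_finiteDimensional _).measurableSet
    · rw [sub_eq_zero, ← map_smul, ← map_smul, innerSL_inj] at h0
      exact mem_line_of_smul_sub_eq_smul_sub hpq
        (mul_ne_zero two_ne_zero (hne _ (hpos (hp hx.2)))) h0
  exact measure_mono_null (subset_sdiff_union _ _) (measure_union_null hoff hline)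

end LevelSets

section LinkPower

variable {σ R ξ : ℝ}

theorem hasDerivAt_linkPower_profile {ρ : ℝ} (hρ : 0 < ρ) :
    HasDerivAt (fun ρ => σ ^ 2 * (R ^ 2 + ρ) ^ (ξ / 2))
      (σ ^ 2 * (ξ / 2 * (R ^ 2 + ρ) ^ (ξ / 2 - 1))) ρ := by
  have hbase : R ^ 2 + ρ ≠ 0 := by positivity
  simpa using (((hasDerivAt_id ρ).const_add (R ^ 2)).rpow_const (p := ξ / 2) (.inl hbase)).const_mul
    (σ ^ 2)

theorem hasNullTies_linkPower {ι : Type*} {b : ι → Plane} (hb : Injective b) (hσ : σ ≠ 0)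
    (hξ : ξ ≠ 0) : HasNullTies volume fun i => linkPower σ R ξ (b i) := fun i j hij c =>
  addHaar_setOf_radial_sub_radial_eq volume (by simp) (by fun_prop)
    (fun _ => hasDerivAt_linkPower_profile) (fun ρ hρ => by positivity) (hb.ne hij) c

end LinkPower

section MobileMeasure

variable {K : ℕ} {Ω : Set Plane} {f : Plane → ℝ} {F : Fin K → Plane → ℝ} {s : Fin K → ℝ → ℝ}
  {g : Fin K → ℝ} {C D : Fin K → Set Plane}

theorem isFiniteMeasure_mobileMeasure (hf_int : IntegrableOn f Ω) :
    IsFiniteMeasure (mobileMeasure Ω f) :=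
  isFiniteMeasure_withDensity_ofReal hf_int.2

theorem mobileMeasure_absolutelyContinuous : mobileMeasure Ω f ≪ volume :=
  (withDensity_absolutelyContinuous _ _).trans Measure.restrict_le_self.absolutelyContinuous

theorem ae_mem_mobileMeasure (hΩ : MeasurableSet Ω) : ∀ᵐ x ∂mobileMeasure Ω f, x ∈ Ω :=
  (withDensity_absolutelyContinuous _ _).ae_le (ae_restrict_mem hΩ)

theorem setIntegral_mobileMeasure (hf_nonneg : ∀ x ∈ Ω, 0 ≤ f x) (hf_int : IntegrableOn f Ω)
    {A : Set Plane} (hA : MeasurableSet A) (hAΩ : A ⊆ Ω) (u : Plane → ℝ) :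
    ∫ x in A, u x ∂mobileMeasure Ω f = ∫ x in A, u x * f x := by
  have hdensity : AEMeasurable (fun x => ENNReal.ofReal (f x)) (volume.restrict Ω) :=
    hf_int.aestronglyMeasurable.aemeasurable.ennreal_ofReal
  rw [mobileMeasure, setIntegral_withDensity_eq_setIntegral_toReal_smul₀ hdensity.restrict
    (.of_forall fun _ => ENNReal.ofReal_lt_top) _ hA,
    Measure.restrict_restrict hA, inter_eq_left.2 hAΩ]
  refine setIntegral_congr_fun hA fun x hx => ?_
  simp only [ENNReal.toReal_ofReal (hf_nonneg x (hAΩ hx)), smul_eq_mul, mul_comm]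

theorem mobilesIn_eq_measureReal (hf_nonneg : ∀ x ∈ Ω, 0 ≤ f x) (hf_int : IntegrableOn f Ω)
    {A : Set Plane} (hA : MeasurableSet A) (hAΩ : A ⊆ Ω) :
    mobilesIn f A = (mobileMeasure Ω f).real A := by
  simpa [mobilesIn] using (setIntegral_mobileMeasure hf_nonneg hf_int hA hAΩ fun _ => 1).symm

theorem integrable_mobileMeasure (hΩ : MeasurableSet Ω) (hf_nonneg : ∀ x ∈ Ω, 0 ≤ f x)
    (hf_int : IntegrableOn f Ω) {u : Plane → ℝ} (hu : IntegrableOn (fun x => u x * f x) Ω) :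
    Integrable u (mobileMeasure Ω f) := by
  have hdensity : AEMeasurable (fun x => (f x).toNNReal) (volume.restrict Ω) :=
    hf_int.aestronglyMeasurable.aemeasurable.real_toNNReal
  refine (integrable_withDensity_iff_integrable_smul₀ hdensity).2 (hu.congr ?_)
  filter_upwards [ae_restrict_mem hΩ] with x hx
  rw [NNReal.smul_def, Real.coe_toNNReal _ (hf_nonneg x hx), smul_eq_mul, mul_comm]

theorem associationCell_ae_eq_priceCell (hΩ : MeasurableSet Ω) (n g : Fin K → ℝ) (i : Fin K) :
    associationCell Ω F s n g i =ᵐ[mobileMeasure Ω f]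
      priceCell F (fun k => s k (n k) + n k * g k) i := by
  refine eventuallyEq_set.2 ?_
  filter_upwards [ae_mem_mobileMeasure hΩ] with x hx
  simp only [associationCell, priceCell, mem_ofPred_eq, hx, true_and, add_assoc]

namespace IsCellPartition

theorem subset (hC : IsCellPartition Ω C) (i : Fin K) : C i ⊆ Ω :=
  hC.iUnion_eq ▸ subset_iUnion C i

theorem isAEPartition {μ : Measure Plane} (hC : IsCellPartition Ω C) (hμ : ∀ᵐ x ∂μ, x ∈ Ω) :
    IsAEPartition μ C where
  nullMeasurableSet i := (hC.measurableSet i).nullMeasurableSet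
  aedisjoint _ _ hij := (hC.disjoint hij).aedisjoint
  ae_exists_mem := hμ.mono fun _ hx => mem_iUnion.1 (hC.iUnion_eq ▸ hx)

theorem measureReal_eq_mobilesIn (hC : IsCellPartition Ω C) (hf_nonneg : ∀ x ∈ Ω, 0 ≤ f x)
    (hf_int : IntegrableOn f Ω) (i : Fin K) :
    (mobileMeasure Ω f).real (C i) = mobilesIn f (C i) :=
  (mobilesIn_eq_measureReal hf_nonneg hf_int (hC.measurableSet i) (hC.subset i)).symm

theorem loadCost_eq_partitionCost (hC : IsCellPartition Ω C) (hf_nonneg : ∀ x ∈ Ω, 0 ≤ f x)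
    (hf_int : IntegrableOn f Ω) : loadCost (mobileMeasure Ω f) F s C = partitionCost F s f C := by
  simp only [loadCost, pricedCost, partitionCost, hC.measureReal_eq_mobilesIn hf_nonneg hf_int,
    setIntegral_mobileMeasure hf_nonneg hf_int (hC.measurableSet _) (hC.subset _)]

end IsCellPartition

theorem exists_isCellPartition_ae_eq [Nonempty (Fin K)] (hΩ : MeasurableSet Ω)
    {μ : Measure Plane} (hμ : ∀ᵐ x ∂μ, x ∈ Ω) {A : Fin K → Set Plane} (hA : IsAEPartition μ A) :
    ∃ C, IsCellPartition Ω C ∧ ∀ i, C i =ᵐ[μ] A i := by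
  obtain ⟨t, htA, hAt, ht, -⟩ := exists_subordinate_pairwise_disjoint hA.nullMeasurableSet
    hA.aedisjoint
  let B (i : Fin K) : Set Plane := t i ∪ (⋃ j, t j)ᶜ
  have hB (i : Fin K) : MeasurableSet (B i) := (ht i).union (MeasurableSet.iUnion ht).compl
  have hC : IsCellPartition Ω fun i => Ω ∩ disjointed B i :=
    { measurableSet := fun i => hΩ.inter
        (disjointedRec (fun _ j hs => hs.diff (hB j)) (hB i))
      disjoint := fun i j hij =>
        ((disjoint_disjointed B) hij).mono inter_subset_right inter_subset_right
      iUnion_eq := by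
        rw [← inter_iUnion, iUnion_disjointed, ← iUnion_union, union_compl_self, inter_univ] }
  have hcover : ∀ᵐ x ∂μ, x ∈ ⋃ j, t j := by
    filter_upwards [hA.ae_exists_mem, ae_all_iff.2 fun i => eventuallyEq_set.1 (hAt i)]
      with x ⟨i, hi⟩ hx using mem_iUnion.2 ⟨i, (hx i).1 hi⟩
  refine ⟨_, hC, (hC.isAEPartition hμ).ae_eq_of_ae_imp hA fun i => ?_⟩
  filter_upwards [hcover] with x hx hxi
  exact htA i ((disjointed_subset B i hxi.2).resolve_right (not_not_intro hx))

theorem isPriceEquilibrium_mobileMeasure_iff (hΩ : MeasurableSet Ω)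
    (hf_nonneg : ∀ x ∈ Ω, 0 ≤ f x) (hf_int : IntegrableOn f Ω) (hC : IsCellPartition Ω C) :
    IsPriceEquilibrium (mobileMeasure Ω f) F s g C ↔
      (∀ i, IsLoadSubgradient (s i) (mobilesIn f (C i)) (g i)) ∧
        ∀ i, C i =ᵐ[mobileMeasure Ω f]
          associationCell Ω F s (fun k => mobilesIn f (C k)) g i := by
  have hcell := associationCell_ae_eq_priceCell (f := f) (F := F) (s := s) hΩ
    (fun k => mobilesIn f (C k)) g
  simp only [isPriceEquilibrium_iff, hC.measureReal_eq_mobilesIn hf_nonneg hf_int]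
  exact and_congr_right' <| forall_congr' fun i =>
    ⟨fun h => h.trans (hcell i).symm, fun h => h.trans (hcell i)⟩

theorem exists_isPriceEquilibrium_mobileMeasure_iff_deriv (hΩ : MeasurableSet Ω)
    (hf_nonneg : ∀ x ∈ Ω, 0 ≤ f x) (hf_int : IntegrableOn f Ω) (hC : IsCellPartition Ω C)
    (hconv : ∀ i, ConvexOn ℝ (Ici 0) (s i))
    (hd : ∀ i, DifferentiableAt ℝ (s i) (mobilesIn f (C i))) :
    (∃ g, IsPriceEquilibrium (mobileMeasure Ω f) F s g C) ↔
      ∀ i, C i =ᵐ[mobileMeasure Ω f] associationCell Ω F s (fun k => mobilesIn f (C k))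
        (fun k => deriv (s k) (mobilesIn f (C k))) i := by
  have hload := hC.measureReal_eq_mobilesIn hf_nonneg hf_int
  refine ⟨fun ⟨g, hg⟩ => ?_, fun hcells => ?_⟩
  · have hgd := hg.of_differentiableAt hconv fun i => hload i ▸ hd i
    simp only [hload] at hgd
    exact ((isPriceEquilibrium_mobileMeasure_iff hΩ hf_nonneg hf_int hC).1 hgd).2
  · exact ⟨_, (isPriceEquilibrium_mobileMeasure_iff hΩ hf_nonneg hf_int hC).2
      ⟨fun i => isLoadSubgradient_deriv (hconv i) (hload i ▸ measureReal_nonneg) (hd i), hcells⟩⟩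

section Optimality

variable [Nonempty (Fin K)] (hΩ : MeasurableSet Ω) (hf_nonneg : ∀ x ∈ Ω, 0 ≤ f x)
  (hf_int : IntegrableOn f Ω) (hpow : ∀ i, IntegrableOn (fun x => F i x * f x) Ω)
  (hties : HasNullTies (mobileMeasure Ω f) F) (hmono : ∀ i, MonotoneOn (s i) (Ici 0))
  (hC : IsCellPartition Ω C) (hCg : IsPriceEquilibrium (mobileMeasure Ω f) F s g C)

include hΩ hf_nonneg hf_int hpow hties hmono hC hCg

theorem IsPriceEquilibrium.isOptimalPartition : IsOptimalPartition Ω F s f C := by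
  have := isFiniteMeasure_mobileMeasure hf_int
  have hF (i : Fin K) := integrable_mobileMeasure hΩ hf_nonneg hf_int (hpow i)
  refine ⟨hC, fun D hD => ?_⟩
  rw [← hC.loadCost_eq_partitionCost hf_nonneg hf_int,
    ← hD.loadCost_eq_partitionCost hf_nonneg hf_int]
  exact hCg.loadCost_le hF hties hmono (hC.isAEPartition (ae_mem_mobileMeasure hΩ))
    (hD.isAEPartition (ae_mem_mobileMeasure hΩ))

theorem IsPriceEquilibrium.ae_eq_of_isOptimalPartition (hD : IsOptimalPartition Ω F s f D)
    (i : Fin K) : D i =ᵐ[mobileMeasure Ω f] C i := by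
  have := isFiniteMeasure_mobileMeasure hf_int
  have hF (i : Fin K) := integrable_mobileMeasure hΩ hf_nonneg hf_int (hpow i)
  refine hCg.ae_eq_of_loadCost_le hF hties hmono (hC.isAEPartition (ae_mem_mobileMeasure hΩ))
    (hD.1.isAEPartition (ae_mem_mobileMeasure hΩ)) ?_ i
  rw [hC.loadCost_eq_partitionCost hf_nonneg hf_int,
    hD.1.loadCost_eq_partitionCost hf_nonneg hf_int]
  exact hD.2 C hC

end Optimality

end MobileMeasure

theorem mainTheorem5_general {K : ℕ} (hK : 0 < K) {Ω : Set Plane} (hΩ : MeasurableSet Ω)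
    {f : Plane → ℝ} (hf_nonneg : ∀ x ∈ Ω, 0 ≤ f x) (hf_int : IntegrableOn f Ω)
    {F : Fin K → Plane → ℝ} (hpow : ∀ i, IntegrableOn (fun x => F i x * f x) Ω)
    (hties : HasNullTies (mobileMeasure Ω f) F) {s : Fin K → ℝ → ℝ}
    (hs_mono : ∀ i, MonotoneOn (s i) (Ici 0)) (hs_conv : ∀ i, ConvexOn ℝ (Ici 0) (s i)) :
    (∃ C : Fin K → Set Plane, IsOptimalPartition Ω F s f C ∧
      ∀ D : Fin K → Set Plane, IsOptimalPartition Ω F s f D →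
        ∀ i, D i =ᵐ[mobileMeasure Ω f] C i) ∧
    (∀ C : Fin K → Set Plane, IsCellPartition Ω C →
      (IsOptimalPartition Ω F s f C ↔
        ∃ g : Fin K → ℝ, (∀ i, IsLoadSubgradient (s i) (mobilesIn f (C i)) (g i)) ∧
          ∀ i, C i =ᵐ[mobileMeasure Ω f]
            associationCell Ω F s (fun k => mobilesIn f (C k)) g i)) ∧
    (∀ C : Fin K → Set Plane, IsCellPartition Ω C →
      (∀ i, DifferentiableAt ℝ (s i) (mobilesIn f (C i))) →
      (IsOptimalPartition Ω F s f C ↔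
        ∀ i, C i =ᵐ[mobileMeasure Ω f]
          associationCell Ω F s (fun k => mobilesIn f (C k))
            (fun k => deriv (s k) (mobilesIn f (C k))) i)) := by
  have : Nonempty (Fin K) := ⟨⟨0, hK⟩⟩
  have := isFiniteMeasure_mobileMeasure hf_int
  have hF (i : Fin K) := integrable_mobileMeasure hΩ hf_nonneg hf_int (hpow i)
  obtain ⟨h, g₀, hg₀⟩ := exists_isPriceEquilibrium hF hties hs_mono hs_conv
  obtain ⟨C₀, hC₀, hC₀_ae⟩ := exists_isCellPartition_ae_eq hΩ (ae_mem_mobileMeasure hΩ)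
    (hties.isAEPartition_priceCell (fun i => (hF i).aemeasurable) h)
  have hC₀_eq : IsPriceEquilibrium (mobileMeasure Ω f) F s g₀ C₀ :=
    hg₀.congr_ae fun i => (hC₀_ae i).symm
  have hunique {D : Fin K → Set Plane} (hD : IsOptimalPartition Ω F s f D) (i : Fin K) :
      D i =ᵐ[mobileMeasure Ω f] C₀ i :=
    hC₀_eq.ae_eq_of_isOptimalPartition hΩ hf_nonneg hf_int hpow hties hs_mono hC₀ hD i
  have hiff {C : Fin K → Set Plane} (hC : IsCellPartition Ω C) : IsOptimalPartition Ω F s f C ↔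
      ∃ g, IsPriceEquilibrium (mobileMeasure Ω f) F s g C :=
    ⟨fun hopt => ⟨g₀, hC₀_eq.congr_ae fun i => (hunique hopt i).symm⟩, fun ⟨_, hg⟩ =>
      hg.isOptimalPartition hΩ hf_nonneg hf_int hpow hties hs_mono hC⟩
  refine ⟨⟨C₀, (hiff hC₀).2 ⟨g₀, hC₀_eq⟩, fun D hD => hunique hD⟩, fun C hC => ?_,
    fun C hC hd => ?_⟩
  · simp only [hiff hC, isPriceEquilibrium_mobileMeasure_iff hΩ hf_nonneg hf_int hC]
  · rw [hiff hC, exists_isPriceEquilibrium_mobileMeasure_iff_deriv hΩ hf_nonneg hf_int hC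
      hs_conv hd]

theorem mainTheorem5 {K : ℕ} (hK : 0 < K)
    (Ω : Set Plane) (hΩ : MeasurableSet Ω)
    (f : Plane → ℝ) (hf_nonneg : ∀ x ∈ Ω, 0 ≤ f x) (hf_int : IntegrableOn f Ω)
    (b : Fin K → Plane) (hb : Function.Injective b)
    (σ R ξ : ℝ) (hσ : 0 < σ) (hR : 0 ≤ R) (hξ : 0 < ξ)
    (hpow : ∀ i, IntegrableOn (fun x => linkPower σ R ξ (b i) x * f x) Ω)
    (MAX : Fin K → ℝ) (hMAX : ∀ i, 0 ≤ MAX i) (κbar : Fin K → ℝ → ℝ)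
    (F : Fin K → Plane → ℝ) (hF : ∀ i, F i = linkPower σ R ξ (b i))
    (s : Fin K → ℝ → ℝ) (hs : ∀ i, s i = overflowPenalty (MAX i) (κbar i))
    (hs_mono : ∀ i, MonotoneOn (s i) (Set.Ici 0))
    (hs_conv : ∀ i, ConvexOn ℝ (Set.Ici 0) (s i)) :
    (∃ C : Fin K → Set Plane, IsOptimalPartition Ω F s f C ∧
      ∀ D : Fin K → Set Plane, IsOptimalPartition Ω F s f D →
        ∀ i, D i =ᵐ[mobileMeasure Ω f] C i) ∧
    (∀ C : Fin K → Set Plane, IsCellPartition Ω C →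
      (IsOptimalPartition Ω F s f C ↔
        ∃ g : Fin K → ℝ, (∀ i, IsLoadSubgradient (s i) (mobilesIn f (C i)) (g i)) ∧
          ∀ i, C i =ᵐ[mobileMeasure Ω f]
            associationCell Ω F s (fun k => mobilesIn f (C k)) g i)) ∧
    (∀ C : Fin K → Set Plane, IsCellPartition Ω C →
      (∀ i, DifferentiableAt ℝ (s i) (mobilesIn f (C i))) →
      (IsOptimalPartition Ω F s f C ↔
        ∀ i, C i =ᵐ[mobileMeasure Ω f]
          associationCell Ω F s (fun k => mobilesIn f (C k))
            (fun k => deriv (s k) (mobilesIn f (C k))) i)) := by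
  obtain rfl : F = fun i => linkPower σ R ξ (b i) := funext hF
  exact mainTheorem5_general hK hΩ hf_nonneg hf_int hpow
    ((hasNullTies_linkPower hb hσ.ne' hξ.ne').mono_ac mobileMeasure_absolutelyContinuous)
    hs_mono hs_conv
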